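/- Let $0 < A^{\mathrm{avg}} \le A^{\max}$. In each stage $n=1,2,\dots$ of the jamming game the attacker jams the channel for a time $A_n\in[0,A^{\max}]$, the $A_n$ being i.i.d. with a distribution $\mu$ on $[0,A^{\max}]$ chosen by the attacker subject to $\mathbb E_\mu[A_n]\le A^{\mathrm{avg}}$. The system then waits for a further delay $D_n\in[0,\infty)$, drawn according to a causal policy $\pi$, which maps $(A_1,\dots,A_n,D_1,\dots,D_{n-1})$ (measurably) to a probability distribution on $[0,\infty)$. Samples are taken at $S_0=0$, $S_n=S_{n-1}+A_n+D_n$. The age $\Delta(t)$ is the time elapsed at $t$ since the last sample, i.e. $\Delta(t)=t-S_n$ for $t\in[S_n,S_{n+1})$, and the average age is $$\overline\Delta(\mu,\pi)=\limsup_{T\to\infty}\frac1T\,\mathbb E\Big[\int_0^T\Delta(t)\,dt\Big].$$ A pair $(\mu,\pi)$ is an equilibrium if $\pi$ minimizes $\overline\Delta(\mu,\cdot)$ over all causal policies, and $\mu$ satisfies the constraint and maximizes $\mu'\mapsto\inf_{\pi'}\overline\Delta(\mu',\pi')$ (the average age under the system's best response) over all $\mu'$ satisfying the constraint. It is a stationary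 equilibrium, written $(\mu,u)$, if moreover $D_n=u(A_n)$ for all $n$, for a deterministic function $u:[0,A^{\max}]\to[0,\infty)$. Then the pair $(\mu^*,u^*)$ with $$\mu^*=\Big(1-\frac{A^{\mathrm{avg}}}{A^{\max}}\Big)\delta_0+\frac{A^{\mathrm{avg}}}{A^{\max}}\,\delta_{A^{\max}},\qquad u^*(a)=(\beta^*-a)^+,\qquad \beta^*=\frac{A^{\max}\sqrt{A^{\mathrm{avg}}}}{\sqrt{A^{\max}}+\sqrt{A^{\mathrm{avg}}}},$$ is a stationary equilibrium, and it is the only one: every stationary equilibrium $(\mu,u)$ satisfies $\mu=\mu^*$ and $u=u^*$ $\mu^*$-almost everywhere (so that the delays $u(A_n)$ and $u^*(A_n)$ agree almost surely). -/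

import Mathlib

open MeasureTheory ProbabilityTheory Filter Set
open scoped NNReal ENNReal

noncomputable section

namespace JammingGame

/-- Jamming times: the interval `[0, Amax]`. -/
abbrev Jam (Amax : ℝ) : Type := Icc (0 : ℝ) Amax

/-- What happens in one stage game: the jamming time and the delay that follows it. -/
abbrev Stage (Amax : ℝ) : Type := Jam Amax × ℝ≥0

/-- What the system knows when it chooses the delay of sample `n + 1`: the jamming times and the
delays of the first `n` stages, and the current jamming time. -/
abbrev History (Amax : ℝ) (n : ℕ) : Type := (Fin n → Stage Amax) × Jam Amax

/-- A (randomized) causal sampling policy: for every history, a probability distribution on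
`[0, ∞)` for the current delay. Stage games are numbered from `0` here. -/
structure CausalPolicy (Amax : ℝ) where
  delay : (n : ℕ) → Kernel (History Amax n) ℝ≥0
  markov : ∀ n, IsMarkovKernel (delay n)

attribute [instance] CausalPolicy.markov

/-- The policy `π` is stationary deterministic with decision function `u`: after every history the
delay is `u` of the current jamming time. -/
def CausalPolicy.IsStationaryDeterministic {Amax : ℝ} (π : CausalPolicy Amax)
    (u : Jam Amax → ℝ≥0) : Prop :=
  ∀ (n : ℕ) (h : History Amax n), π.delay n h = Measure.dirac (u h.2)

/-- The history after stages `0, …, n` once the jamming time of stage `n + 1` is known. -/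
def nextHistory {Amax : ℝ} (n : ℕ) (x : (Finset.Iic n → Stage Amax) × Jam Amax) :
    History Amax (n + 1) :=
  (fun i => x.1 ⟨i, Finset.mem_Iic.2 (Nat.le_of_lt_succ i.2)⟩, x.2)

theorem measurable_nextHistory {Amax : ℝ} (n : ℕ) :
    Measurable (nextHistory (Amax := Amax) n) := by
  refine Measurable.prodMk (measurable_pi_iff.2 fun i => ?_) measurable_snd
  exact (measurable_pi_apply _).comp measurable_fst

/-- The history of the first stage once its jamming time is known. -/
def firstHistory {Amax : ℝ} (a : Jam Amax) : History Amax 0 := (Fin.elim0, a)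

theorem measurable_firstHistory {Amax : ℝ} : Measurable (firstHistory (Amax := Amax)) :=
  Measurable.prodMk measurable_const measurable_id

/-- Law of the first stage: the jamming time is drawn from `μ`, then the delay from `π`. -/
def firstLaw {Amax : ℝ} (μ : ProbabilityMeasure (Jam Amax)) (π : CausalPolicy Amax) :
    Measure (Stage Amax) :=
  (μ : Measure (Jam Amax)) ⊗ₘ ((π.delay 0).comap firstHistory measurable_firstHistory)

/-- Conditional law of stage `n + 1` given stages `0, …, n`: the jamming time is drawn from `μ`
independently of the past, then the delay from `π`. -/
def stepLaw {Amax : ℝ} (μ : ProbabilityMeasure (Jam Amax)) (π : CausalPolicy Amax) (n : ℕ) :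
    Kernel (Finset.Iic n → Stage Amax) (Stage Amax) :=
  (Kernel.const _ (μ : Measure (Jam Amax))) ⊗ₖ
    ((π.delay (n + 1)).comap (nextHistory n) (measurable_nextHistory n))

instance {Amax : ℝ} (μ : ProbabilityMeasure (Jam Amax)) (π : CausalPolicy Amax) (n : ℕ) :
    IsMarkovKernel (stepLaw μ π n) := by
  unfold stepLaw; infer_instance

/-- The law of the whole play `(A₁, D₁), (A₂, D₂), …`. -/
def playLaw {Amax : ℝ} (μ : ProbabilityMeasure (Jam Amax)) (π : CausalPolicy Amax) :
    Measure (ℕ → Stage Amax) :=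
  Kernel.trajMeasure (X := fun _ => Stage Amax) (firstLaw μ π) (stepLaw μ π)

/-- The sampling times: `S₀ = 0` and `Sₙ = Sₙ₋₁ + Aₙ + Dₙ`. -/
def samplingTime {Amax : ℝ} (ω : ℕ → Stage Amax) : ℕ → ℝ
  | 0 => 0
  | n + 1 => samplingTime ω n + ((ω n).1 : ℝ) + ((ω n).2 : ℝ)

/-- The age of information at time `t`: the time elapsed since the last sample taken up to time
`t`. It is `t - Sₙ` for `t ∈ [Sₙ, Sₙ₊₁)`; as an infimum it also makes sense at times beyond an
accumulation point of the sampling times. -/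
def age {Amax : ℝ} (ω : ℕ → Stage Amax) (t : ℝ) : ℝ≥0∞ :=
  ⨅ (n : ℕ) (_ : samplingTime ω n ≤ t), ENNReal.ofReal (t - samplingTime ω n)

/-- The long-run average age `limsup_{T → ∞} (1 / T) E [∫₀ᵀ Δ(t) dt]`. -/
def avgAge {Amax : ℝ} (μ : ProbabilityMeasure (Jam Amax)) (π : CausalPolicy Amax) : ℝ≥0∞ :=
  limsup (fun T : ℝ => (ENNReal.ofReal T)⁻¹ *
    ∫⁻ ω, (∫⁻ t in Icc (0 : ℝ) T, age ω t) ∂(playLaw μ π)) atTop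

/-- The average age under the system's best responses to `μ`: the minimal value of the system's
optimization problem over all causal policies. -/
def bestResponseAge {Amax : ℝ} (μ : ProbabilityMeasure (Jam Amax)) : ℝ≥0∞ :=
  ⨅ π : CausalPolicy Amax, avgAge μ π

/-- The constraint on the mean jamming time. -/
def IsFeasible {Amax : ℝ} (Aavg : ℝ) (μ : ProbabilityMeasure (Jam Amax)) : Prop :=
  ∫ a, (a : ℝ) ∂(μ : Measure (Jam Amax)) ≤ Aavg

/-- `(μ, π)` is an equilibrium: `π` minimizes the average age under `μ` among all causal policies,
and `μ` is feasible and maximizes, among the feasible distributions, the average age under the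
system's best response. -/
structure IsEquilibrium {Amax : ℝ} (Aavg : ℝ) (μ : ProbabilityMeasure (Jam Amax))
    (π : CausalPolicy Amax) : Prop where
  system_optimal : ∀ π' : CausalPolicy Amax, avgAge μ π ≤ avgAge μ π'
  feasible : IsFeasible Aavg μ
  attacker_optimal : ∀ μ' : ProbabilityMeasure (Jam Amax), IsFeasible Aavg μ' →
    bestResponseAge μ' ≤ bestResponseAge μ

/-- `(μ, u)` is a stationary equilibrium: the stationary deterministic policy with decision
function `u` forms an equilibrium with `μ`. -/
def IsStationaryEquilibrium {Amax : ℝ} (Aavg : ℝ) (μ : ProbabilityMeasure (Jam Amax))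
    (u : Jam Amax → ℝ≥0) : Prop :=
  ∃ π : CausalPolicy Amax, π.IsStationaryDeterministic u ∧ IsEquilibrium Aavg μ π

end JammingGame

end

/-!
Write `X = A + D` for the length of a stage. The age accumulated during a stage is `X² / 2`, so a
policy has average age at least `β` as soon as each stage has a nonnegative mean cost `X² / 2 - β X`.
Given the jamming time `A`, the delay minimizing this cost leads to `X = max A β`, with the cost
`(((A - β)⁺)² - β²) / 2`. Hence the best response to an attack is the threshold policy at the root
`β` of `E[((A - β)⁺)²] = β²`, and `β` is then its average age.

The function `((a - β)⁺)²` is convex on `[0, Amax]` and vanishes at `0`, so it lies below the chord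
`a (Amax - β)² / Amax`, strictly except at the end points. For the value `β` at which the two-point
attack satisfies the root equation this gives `E[((A - β)⁺)²] ≤ β²` for every feasible attack, with
equality only for the two-point attack (`integral_sq_max_sub_le`,
`ae_eq_zero_or_eq_and_integral_eq`, `eq_twoPoint`). Only the threshold policy at this one `β` is
therefore needed: it bounds the best-response age of every feasible attack (`avgAge_threshold_le`),
strictly below `β` unless the attack is the two-point one, while no causal policy beats `β` against
the two-point attack (`ofReal_le_avgAge_twoPoint`). If a stationary policy with decision function
`u` attains `β` there, equality in the pointwise minimization identifies `u` at the atoms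
(`ae_eq_threshold_of_avgAge_le`).

The passage from stages to the time average rests on one fact about the law of the play: whatever
the policy, `Aₙ` has law `μ` and is independent of `Sₙ` (`lintegral_samplingTime_jam`). For the
upper bound (`avgAge_le_of_isStationaryDeterministic`) it is used as in Wald's identity, for the
stages started up to time `T`. For the lower bound (`ofReal_le_avgAge`), stages are cut off at `T`
and the age collected so far plus `β` times the time left until `T - C` is shown to be nondecreasing
in the mean from stage to stage; the margin `C` makes the cut-off harmless, and `E[exp (-Sₙ)] → 0`
disposes of what is left after many stages.
-/

namespace JammingGame

variable {Amax : ℝ}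

/-! ### Law of the play -/

instance instIsProbabilityMeasureFirstLaw (μ : ProbabilityMeasure (Jam Amax))
    (π : CausalPolicy Amax) : IsProbabilityMeasure (firstLaw μ π) := by
  unfold firstLaw; infer_instance

instance instIsProbabilityMeasurePlayLaw (μ : ProbabilityMeasure (Jam Amax))
    (π : CausalPolicy Amax) : IsProbabilityMeasure (playLaw μ π) := by
  unfold playLaw; infer_instance

/-- Length `Aₙ + Dₙ` of stage `n`. -/
noncomputable def stageLength (x : Stage Amax) : ℝ := (x.1 : ℝ) + (x.2 : ℝ)

theorem stageLength_nonneg (x : Stage Amax) : 0 ≤ stageLength x :=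
  add_nonneg x.1.2.1 x.2.2

theorem measurable_stageLength : Measurable (stageLength (Amax := Amax)) := by
  unfold stageLength; fun_prop

theorem samplingTime_succ (ω : ℕ → Stage Amax) (n : ℕ) :
    samplingTime ω (n + 1) = samplingTime ω n + stageLength (ω n) := by
  simp [samplingTime, stageLength, add_assoc]

theorem samplingTime_eq_sum (ω : ℕ → Stage Amax) (n : ℕ) :
    samplingTime ω n = ∑ i ∈ Finset.range n, stageLength (ω i) := by
  induction n with
  | zero => simp [samplingTime]
  | succ n ih => rw [samplingTime_succ, ih, Finset.sum_range_succ]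

theorem monotone_samplingTime (ω : ℕ → Stage Amax) : Monotone (samplingTime ω) :=
  monotone_nat_of_le_succ fun n => by
    rw [samplingTime_succ]; linarith [stageLength_nonneg (ω n)]

theorem samplingTime_nonneg (ω : ℕ → Stage Amax) (n : ℕ) : 0 ≤ samplingTime ω n :=
  monotone_samplingTime ω (Nat.zero_le n)

@[fun_prop]
theorem measurable_samplingTime (n : ℕ) :
    Measurable fun ω : ℕ → Stage Amax => samplingTime ω n := by
  simp only [samplingTime_eq_sum]
  exact Finset.measurable_sum _ fun i _ => measurable_stageLength.comp (measurable_pi_apply i)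

/-- The time `Sₙ₊₁` as a function of the stages `0, …, n`. -/
theorem samplingTime_succ_eq_frestrictLe (ω : ℕ → Stage Amax) (n : ℕ) :
    samplingTime ω (n + 1) =
      ∑ i, stageLength (Preorder.frestrictLe (π := fun _ => Stage Amax) n ω i) := by
  have h : Finset.range (n + 1) = Finset.Iic n := by ext i; simp
  rw [samplingTime_eq_sum, h]
  exact (Finset.sum_coe_sort (Finset.Iic n) fun i => stageLength (ω i)).symm

theorem map_playLaw_zero (μ : ProbabilityMeasure (Jam Amax)) (π : CausalPolicy Amax) :
    (playLaw μ π).map (fun ω => ω 0) = firstLaw μ π := by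
  have h0 : (fun ω : ℕ → Stage Amax => ω 0) =
      (MeasurableEquiv.piUnique (fun _ : Finset.Iic 0 => Stage Amax)) ∘
        (Preorder.frestrictLe (π := fun _ => Stage Amax) 0) := by
    ext ω <;> rfl
  rw [h0, ← Measure.map_map (by fun_prop) (by fun_prop), playLaw, Kernel.trajMeasure,
    Measure.map_comp _ _ (by fun_prop), Kernel.traj_map_frestrictLe, Kernel.partialTraj_self,
    Measure.id_comp, Measure.map_map (by fun_prop) (by fun_prop),
    MeasurableEquiv.self_comp_symm, Measure.map_id]

theorem lintegral_playLaw_zero (μ : ProbabilityMeasure (Jam Amax)) (π : CausalPolicy Amax)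
    {g : Stage Amax → ℝ≥0∞} (hg : Measurable g) :
    ∫⁻ ω, g (ω 0) ∂playLaw μ π =
      ∫⁻ a, ∫⁻ d, g (a, d) ∂π.delay 0 (firstHistory a) ∂(μ : Measure (Jam Amax)) := by
  rw [← lintegral_map (f := g) (g := fun ω : ℕ → Stage Amax => ω 0) hg (by fun_prop),
    map_playLaw_zero, firstLaw, Measure.lintegral_compProd hg]
  rfl

theorem lintegral_playLaw_succ (μ : ProbabilityMeasure (Jam Amax)) (π : CausalPolicy Amax) (n : ℕ)
    {g : (Finset.Iic n → Stage Amax) × Stage Amax → ℝ≥0∞} (hg : Measurable g) :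
    ∫⁻ ω, g (Preorder.frestrictLe (π := fun _ => Stage Amax) n ω, ω (n + 1)) ∂playLaw μ π =
      ∫⁻ ω, ∫⁻ a, ∫⁻ d, g (Preorder.frestrictLe (π := fun _ => Stage Amax) n ω, (a, d))
          ∂π.delay (n + 1)
            (nextHistory n (Preorder.frestrictLe (π := fun _ => Stage Amax) n ω, a))
        ∂(μ : Measure (Jam Amax)) ∂playLaw μ π := by
  have hm := Kernel.map_frestrictLe_trajMeasure_compProd_eq_map_trajMeasure
    (X := fun _ => Stage Amax) (μ₀ := firstLaw μ π) (κ := stepLaw μ π) (a := n)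
  rw [← lintegral_map (f := g)
    (g := fun ω : ℕ → Stage Amax =>
      (Preorder.frestrictLe (π := fun _ => Stage Amax) n ω, ω (n + 1)))
    hg (by fun_prop), playLaw, ← hm, Measure.lintegral_compProd hg,
    lintegral_map hg.lintegral_kernel_prod_right' (by fun_prop)]
  refine lintegral_congr fun ω => ?_
  rw [stepLaw, Kernel.lintegral_compProd _ _ _ (by fun_prop)]
  rfl

/-- The jamming time of stage `n` has law `μ` and is independent of the sampling time `Sₙ`,
whatever the policy. -/
theorem lintegral_samplingTime_jam (μ : ProbabilityMeasure (Jam Amax)) (π : CausalPolicy Amax)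
    (n : ℕ) {w : ℝ × Jam Amax → ℝ≥0∞} (hw : Measurable w) :
    ∫⁻ ω, w (samplingTime ω n, (ω n).1) ∂playLaw μ π =
      ∫⁻ ω, ∫⁻ a, w (samplingTime ω n, a) ∂(μ : Measure (Jam Amax)) ∂playLaw μ π := by
  cases n with
  | zero =>
    simp only [samplingTime]
    rw [lintegral_playLaw_zero μ π (g := fun x => w (0, x.1)) (by fun_prop)]
    simp
  | succ n =>
    simp only [samplingTime_succ_eq_frestrictLe]
    have hs : Measurable fun h : Finset.Iic n → Stage Amax => ∑ i, stageLength (h i) :=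
      Finset.measurable_sum _ fun i _ => measurable_stageLength.comp (measurable_pi_apply i)
    rw [lintegral_playLaw_succ μ π n (g := fun x => w (∑ i, stageLength (x.1 i), x.2.1))
      (hw.comp ((hs.comp measurable_fst).prodMk (by fun_prop)))]
    simp

theorem CausalPolicy.IsStationaryDeterministic.measurable {π : CausalPolicy Amax}
    {u : Jam Amax → ℝ≥0} (h : π.IsStationaryDeterministic u) : Measurable u := by
  intro s hs
  have h1 : Measurable fun a : Jam Amax => π.delay 0 (firstHistory a) s :=
    ((π.delay 0).measurable_coe hs).comp measurable_firstHistory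
  have h2 : u ⁻¹' s = (fun a : Jam Amax => π.delay 0 (firstHistory a) s) ⁻¹' {1} := by
    ext a
    by_cases ha : u a ∈ s <;> simp [h 0, firstHistory, Measure.dirac_apply' _ hs, ha]
  rw [h2]
  exact h1 (measurableSet_singleton _)

/-- Under a stationary deterministic policy, almost surely every delay is `u` of the jamming
time. -/
theorem CausalPolicy.IsStationaryDeterministic.ae_delay_eq {π : CausalPolicy Amax}
    {u : Jam Amax → ℝ≥0} (h : π.IsStationaryDeterministic u)
    (μ : ProbabilityMeasure (Jam Amax)) :
    ∀ᵐ ω ∂playLaw μ π, ∀ n, (ω n).2 = u (ω n).1 := by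
  have hu := h.measurable
  rw [ae_all_iff]
  intro n
  have hs : MeasurableSet {x : Stage Amax | x.2 = u x.1}ᶜ :=
    (measurableSet_eq_fun measurable_snd (hu.comp measurable_fst)).compl
  have hg : Measurable ({x : Stage Amax | x.2 = u x.1}ᶜ.indicator (1 : Stage Amax → ℝ≥0∞)) :=
    measurable_one.indicator hs
  suffices h0 : ∫⁻ ω, {x : Stage Amax | x.2 = u x.1}ᶜ.indicator 1 (ω n) ∂playLaw μ π = 0 by
    have h1 := (lintegral_eq_zero_iff
      (hg.comp (measurable_pi_apply n : Measurable fun ω : ℕ → Stage Amax => ω n))).1 h0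
    filter_upwards [h1] with ω hω
    by_contra hne
    simp [hne] at hω
  cases n with
  | zero =>
    rw [lintegral_playLaw_zero μ π hg]
    simp_rw [h 0, lintegral_dirac]
    simp [firstHistory]
  | succ n =>
    rw [lintegral_playLaw_succ μ π n (g := fun x => {x : Stage Amax | x.2 = u x.1}ᶜ.indicator 1 x.2)
      (hg.comp measurable_snd)]
    simp_rw [h (n + 1), lintegral_dirac]
    simp [nextHistory]

/-- The policy which plays the delay `u a` after every jamming time `a`. -/
noncomputable def stationaryPolicy (u : Jam Amax → ℝ≥0) (hu : Measurable u) :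
    CausalPolicy Amax where
  delay n := Kernel.deterministic (fun h : History Amax n => u h.2) (hu.comp measurable_snd)
  markov _ := inferInstance

theorem isStationaryDeterministic_stationaryPolicy (u : Jam Amax → ℝ≥0) (hu : Measurable u) :
    (stationaryPolicy u hu).IsStationaryDeterministic u := fun _ _ =>
  Kernel.deterministic_apply (hu.comp measurable_snd) _

/-! ### The age along a play -/

theorem age_le {ω : ℕ → Stage Amax} {t : ℝ} {n : ℕ} (h : samplingTime ω n ≤ t) :
    age ω t ≤ ENNReal.ofReal (t - samplingTime ω n) :=
  iInf₂_le n h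

theorem le_age {ω : ℕ → Stage Amax} {t : ℝ} {n : ℕ} (h : t < samplingTime ω (n + 1)) :
    ENNReal.ofReal (t - samplingTime ω n) ≤ age ω t := by
  refine le_iInf₂ fun k hk => ?_
  have hkn : k ≤ n := by
    by_contra! hlt
    exact absurd (hk.trans_lt h) (not_lt.2 (monotone_samplingTime ω hlt))
  exact ENNReal.ofReal_le_ofReal (by linarith [monotone_samplingTime ω hkn])

theorem lintegral_Ico_ofReal_sub {a b : ℝ} (hab : a ≤ b) :
    ∫⁻ t in Ico a b, ENNReal.ofReal (t - a) = ENNReal.ofReal ((b - a) ^ 2 / 2) := by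
  rw [← ofReal_integral_eq_lintegral_ofReal]
  · rw [integral_Ico_eq_integral_Ioc, ← intervalIntegral.integral_of_le hab,
      intervalIntegral.integral_sub (by simp) (by simp), integral_id]
    simp only [intervalIntegral.integral_const, smul_eq_mul]
    congr 1; ring
  · exact ((continuous_id.sub continuous_const).integrableOn_Icc (μ := volume)
      (a := a) (b := b)).mono_set Ico_subset_Icc_self
  · filter_upwards [ae_restrict_mem measurableSet_Ico] with t ht
    exact sub_nonneg.2 ht.1

/-- The age accumulated up to time `T` is at least the sum of the contributions of the first
stages, each of them cut off at time `T`. -/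
theorem sum_le_lintegral_age (ω : ℕ → Stage Amax) {T : ℝ} (hT : 0 ≤ T) (K : ℕ) :
    ∑ n ∈ Finset.range K, ENNReal.ofReal
        ((min (samplingTime ω (n + 1)) T - min (samplingTime ω n) T) ^ 2 / 2) ≤
      ∫⁻ t in Icc (0 : ℝ) T, age ω t := by
  suffices h : ∑ n ∈ Finset.range K, ENNReal.ofReal
        ((min (samplingTime ω (n + 1)) T - min (samplingTime ω n) T) ^ 2 / 2) ≤
      ∫⁻ t in Ico (0 : ℝ) (min (samplingTime ω K) T), age ω t from
    h.trans (lintegral_mono_set fun t ht => ⟨ht.1, ht.2.le.trans (min_le_right _ _)⟩)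
  induction K with
  | zero => simp
  | succ K ih =>
    have hmono : min (samplingTime ω K) T ≤ min (samplingTime ω (K + 1)) T :=
      min_le_min_right T (monotone_samplingTime ω K.le_succ)
    have h0 : 0 ≤ min (samplingTime ω K) T := le_min (samplingTime_nonneg ω K) hT
    rw [Finset.sum_range_succ, ← Ico_union_Ico_eq_Ico h0 hmono,
      lintegral_union measurableSet_Ico (Set.Ico_disjoint_Ico_same)]
    refine add_le_add ih ?_
    rw [← lintegral_Ico_ofReal_sub hmono]
    refine setLIntegral_mono' measurableSet_Ico fun t ht => ?_
    have ht2 := lt_min_iff.1 ht.2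
    have hK : samplingTime ω K ≤ min (samplingTime ω K) T := by
      rcases min_choice (samplingTime ω K) T with h | h
      · exact h.ge
      · exact absurd ht2.2 (not_lt.2 (h ▸ ht.1))
    exact (ENNReal.ofReal_le_ofReal (by linarith)).trans (le_age ht2.1)

/-- If the sample `K` is taken after time `T`, the age accumulated up to time `T` is at most the
sum of the full contributions of the stages started up to time `T`. -/
theorem lintegral_age_le_sum (ω : ℕ → Stage Amax) {T : ℝ} {K : ℕ} (hK : T < samplingTime ω K) :
    ∫⁻ t in Icc (0 : ℝ) T, age ω t ≤ ∑ n ∈ Finset.range K,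
      if samplingTime ω n ≤ T then ENNReal.ofReal (stageLength (ω n) ^ 2 / 2) else 0 := by
  have key : ∀ K : ℕ, ∫⁻ t in Icc (0 : ℝ) T ∩ Iio (samplingTime ω K), age ω t ≤
      ∑ n ∈ Finset.range K,
        if samplingTime ω n ≤ T then ENNReal.ofReal (stageLength (ω n) ^ 2 / 2) else 0 := by
    intro K
    induction K with
    | zero =>
      have : Icc (0 : ℝ) T ∩ Iio (samplingTime ω 0) = ∅ := by
        ext t; simp only [samplingTime, mem_inter_iff, mem_Icc, mem_Iio, mem_empty_iff_false,
          iff_false]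
        exact fun h => absurd h.2 (not_lt.2 h.1.1)
      simp [this]
    | succ K ih =>
      rw [Finset.sum_range_succ]
      split_ifs with hKT
      · have hsub : Icc (0 : ℝ) T ∩ Iio (samplingTime ω (K + 1)) ⊆
            (Icc (0 : ℝ) T ∩ Iio (samplingTime ω K)) ∪
              Ico (samplingTime ω K) (samplingTime ω (K + 1)) := fun t ht =>
          (lt_or_ge t (samplingTime ω K)).elim (fun h => .inl ⟨ht.1, h⟩) fun h => .inr ⟨h, ht.2⟩
        refine (lintegral_mono_set hsub).trans ((lintegral_union_le _ _ _).trans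
          (add_le_add ih ?_))
        have hX : stageLength (ω K) = samplingTime ω (K + 1) - samplingTime ω K := by
          rw [samplingTime_succ]; ring
        rw [hX, ← lintegral_Ico_ofReal_sub (monotone_samplingTime ω K.le_succ)]
        exact setLIntegral_mono' measurableSet_Ico fun t ht => age_le ht.1
      · rw [add_zero]
        have hsub : Icc (0 : ℝ) T ∩ Iio (samplingTime ω (K + 1)) ⊆
            Icc (0 : ℝ) T ∩ Iio (samplingTime ω K) := fun t ht =>
          ⟨ht.1, ht.1.2.trans_lt (not_le.1 hKT)⟩
        exact (lintegral_mono_set hsub).trans ih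
  convert key K using 2
  rw [inter_eq_left.2 fun t ht => ht.2.trans_lt hK]

theorem sum_stageLength_le (ω : ℕ → Stage Amax) {T B : ℝ}
    (hX : ∀ n, stageLength (ω n) ≤ B) (K : ℕ) :
    (∑ n ∈ Finset.range K,
      if samplingTime ω n ≤ T then ENNReal.ofReal (stageLength (ω n)) else 0) ≤
        ENNReal.ofReal (T + B) := by
  suffices h : (∑ n ∈ Finset.range K,
      if samplingTime ω n ≤ T then ENNReal.ofReal (stageLength (ω n)) else 0) ≤
        ENNReal.ofReal (min (samplingTime ω K) (T + B)) from
    h.trans (ENNReal.ofReal_le_ofReal (min_le_right _ _))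
  induction K with
  | zero => simp
  | succ K ih =>
    rw [Finset.sum_range_succ]
    have hs := samplingTime_succ ω K
    have h0 := stageLength_nonneg (ω K)
    split_ifs with h
    · have h1 := ih.trans (ENNReal.ofReal_le_ofReal (min_le_left _ _))
      refine (add_le_add_left h1 _).trans ?_
      rw [← ENNReal.ofReal_add (samplingTime_nonneg ω K) h0]
      exact ENNReal.ofReal_le_ofReal (le_min (by linarith) (by linarith [hX K]))
    · rw [add_zero]
      exact ih.trans (ENNReal.ofReal_le_ofReal (min_le_min_right _ (by linarith)))

/-! ### Bounds for the average age -/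

theorem tendsto_inv_ofReal_mul_ofReal (c b : ℝ) :
    Tendsto (fun T : ℝ => (ENNReal.ofReal T)⁻¹ * ENNReal.ofReal (c * (T + b))) atTop
      (nhds (ENNReal.ofReal c)) := by
  have h1 : Tendsto (fun T : ℝ => c * (1 + b / T)) atTop (nhds c) := by
    have := (tendsto_const_nhds (x := b)).div_atTop (tendsto_id (α := ℝ) (x := atTop))
    simpa using (this.const_add 1).const_mul c
  refine (ENNReal.tendsto_ofReal h1).congr' ?_
  filter_upwards [eventually_gt_atTop 0] with T hT
  rw [← ENNReal.ofReal_inv_of_pos hT, ← ENNReal.ofReal_mul (by positivity)]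
  congr 1
  field_simp

/-- Renewal-reward upper bound: if under a stationary deterministic policy the stage length
`X = A + u A` is bounded, bounded away from zero and `E[X² / 2] ≤ c E[X]`, then the average age is
at most `c`. -/
theorem avgAge_le_of_isStationaryDeterministic {μ : ProbabilityMeasure (Jam Amax)}
    {π : CausalPolicy Amax} {u : Jam Amax → ℝ≥0} (h : π.IsStationaryDeterministic u)
    {b B c : ℝ} (hb : 0 < b) (hbX : ∀ a : Jam Amax, b ≤ stageLength (a, u a))
    (hXB : ∀ a : Jam Amax, stageLength (a, u a) ≤ B) (hc : 0 ≤ c)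
    (hint : ∫⁻ a, ENNReal.ofReal (stageLength (a, u a) ^ 2 / 2) ∂(μ : Measure (Jam Amax)) ≤
      ENNReal.ofReal c * ∫⁻ a, ENNReal.ofReal (stageLength (a, u a)) ∂(μ : Measure (Jam Amax))) :
    avgAge μ π ≤ ENNReal.ofReal c := by
  have hu := h.measurable
  have hX : Measurable fun a : Jam Amax => stageLength (a, u a) :=
    measurable_stageLength.comp (by fun_prop)
  have hae := h.ae_delay_eq μ
  refine (limsup_le_limsup ?_).trans (tendsto_inv_ofReal_mul_ofReal c B).limsup_eq.le
  refine Eventually.of_forall fun T => ?_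
  dsimp only
  gcongr
  obtain ⟨K, hK⟩ := exists_nat_gt (T / b)
  rw [div_lt_iff₀ hb] at hK
  -- Stage `n` starts before `T` independently of its jamming time.
  have hsep : ∀ (n : ℕ) (f : ℝ → ℝ), Measurable f →
      ∫⁻ ω, (if samplingTime ω n ≤ T then ENNReal.ofReal (f (stageLength (ω n))) else 0)
        ∂playLaw μ π = ∫⁻ ω, (if samplingTime ω n ≤ T then
          ∫⁻ a, ENNReal.ofReal (f (stageLength (a, u a))) ∂(μ : Measure (Jam Amax)) else 0)
            ∂playLaw μ π := by
    intro n f hf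
    have hw : Measurable fun x : ℝ × Jam Amax =>
        if x.1 ≤ T then ENNReal.ofReal (f (stageLength (x.2, u x.2))) else 0 :=
      Measurable.ite (measurableSet_le measurable_fst measurable_const)
        (hf.comp (hX.comp measurable_snd)).ennreal_ofReal measurable_const
    have e1 := lintegral_samplingTime_jam μ π n hw
    dsimp only at e1
    rw [lintegral_congr_ae (g := fun ω => if samplingTime ω n ≤ T then
      ENNReal.ofReal (f (stageLength ((ω n).1, u (ω n).1))) else 0), e1]
    · refine lintegral_congr fun ω => ?_
      split_ifs <;> simp
    · filter_upwards [hae] with ω hω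
      rw [← hω n]
  have hmeas : ∀ (n : ℕ) (f : ℝ → ℝ), Measurable f → Measurable fun ω : ℕ → Stage Amax =>
      if samplingTime ω n ≤ T then ENNReal.ofReal (f (stageLength (ω n))) else 0 := fun n f hf =>
    Measurable.ite (measurableSet_le (measurable_samplingTime n) measurable_const)
      (hf.comp (measurable_stageLength.comp (measurable_pi_apply n))).ennreal_ofReal
      measurable_const
  calc ∫⁻ ω, (∫⁻ t in Icc (0 : ℝ) T, age ω t) ∂playLaw μ π
      ≤ ∫⁻ ω, (∑ n ∈ Finset.range K, if samplingTime ω n ≤ T then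
          ENNReal.ofReal (stageLength (ω n) ^ 2 / 2) else 0) ∂playLaw μ π := by
        refine lintegral_mono_ae ?_
        filter_upwards [hae] with ω hω
        refine lintegral_age_le_sum ω (hK.trans_le ?_)
        rw [samplingTime_eq_sum, ← nsmul_eq_mul]
        refine (Finset.card_nsmul_le_sum (Finset.range K) (fun i => stageLength (ω i)) b
          fun i _ => ?_).trans' (by simp)
        have := hbX (ω i).1
        rwa [← hω i] at this
    _ = ∑ n ∈ Finset.range K, ∫⁻ ω, (if samplingTime ω n ≤ T then
          ∫⁻ a, ENNReal.ofReal (stageLength (a, u a) ^ 2 / 2) ∂(μ : Measure (Jam Amax)) else 0)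
            ∂playLaw μ π := by
        rw [lintegral_finsetSum _ fun n _ => hmeas n (fun x => x ^ 2 / 2) (by fun_prop)]
        exact Finset.sum_congr rfl fun n _ => hsep n (fun x => x ^ 2 / 2) (by fun_prop)
    _ ≤ ∑ n ∈ Finset.range K, ENNReal.ofReal c * ∫⁻ ω, (if samplingTime ω n ≤ T then
          ∫⁻ a, ENNReal.ofReal (stageLength (a, u a)) ∂(μ : Measure (Jam Amax)) else 0)
            ∂playLaw μ π := by
        refine Finset.sum_le_sum fun n _ => ?_
        rw [← lintegral_const_mul' _ _ ENNReal.ofReal_ne_top]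
        refine lintegral_mono fun ω => ?_
        dsimp only
        split_ifs
        · exact hint
        · simp
    _ = ENNReal.ofReal c * ∫⁻ ω, (∑ n ∈ Finset.range K, if samplingTime ω n ≤ T then
          ENNReal.ofReal (stageLength (ω n)) else 0) ∂playLaw μ π := by
        rw [lintegral_finsetSum _ fun n _ => hmeas n (fun x => x) measurable_id, Finset.mul_sum]
        exact Finset.sum_congr rfl fun n _ => by rw [hsep n (fun x => x) measurable_id]
    _ ≤ ENNReal.ofReal c * ∫⁻ _, ENNReal.ofReal (T + B) ∂playLaw μ π := by
        gcongr ENNReal.ofReal c * ?_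
        refine lintegral_mono_ae ?_
        filter_upwards [hae] with ω hω
        refine sum_stageLength_le ω (fun n => ?_) K
        have := hXB (ω n).1
        rwa [← hω n] at this
    _ = ENNReal.ofReal (c * (T + B)) := by
        rw [lintegral_const, measure_univ, mul_one, ENNReal.ofReal_mul hc]

/-- The jamming times alone drive the sampling times to infinity: the exponential moments of `-Sₙ`
decay geometrically under every policy, unless there is no jamming. -/
theorem lintegral_exp_neg_samplingTime_le (μ : ProbabilityMeasure (Jam Amax))
    (π : CausalPolicy Amax) (n : ℕ) :
    ∫⁻ ω, ENNReal.ofReal (Real.exp (-samplingTime ω n)) ∂playLaw μ π ≤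
      (∫⁻ a, ENNReal.ofReal (Real.exp (-(a : ℝ))) ∂(μ : Measure (Jam Amax))) ^ n := by
  induction n with
  | zero => simp [samplingTime]
  | succ n ih =>
    have hm : Measurable fun a : Jam Amax => ENNReal.ofReal (Real.exp (-(a : ℝ))) := by fun_prop
    calc ∫⁻ ω, ENNReal.ofReal (Real.exp (-samplingTime ω (n + 1))) ∂playLaw μ π
        ≤ ∫⁻ ω, ENNReal.ofReal (Real.exp (-samplingTime ω n)) *
            ENNReal.ofReal (Real.exp (-((ω n).1 : ℝ))) ∂playLaw μ π := by
          refine lintegral_mono fun ω => ?_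
          rw [← ENNReal.ofReal_mul (Real.exp_pos _).le, ← Real.exp_add]
          refine ENNReal.ofReal_le_ofReal (Real.exp_le_exp.2 ?_)
          have := (ω n).2.2
          rw [samplingTime_succ, stageLength]; linarith
      _ = (∫⁻ ω, ENNReal.ofReal (Real.exp (-samplingTime ω n)) ∂playLaw μ π) *
            ∫⁻ a, ENNReal.ofReal (Real.exp (-(a : ℝ))) ∂(μ : Measure (Jam Amax)) := by
          rw [lintegral_samplingTime_jam μ π n (w := fun x : ℝ × Jam Amax =>
            ENNReal.ofReal (Real.exp (-x.1)) * ENNReal.ofReal (Real.exp (-(x.2 : ℝ))))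
            (by fun_prop), ← lintegral_mul_const _ (by fun_prop)]
          refine lintegral_congr fun ω => ?_
          dsimp only
          exact lintegral_const_mul _ hm
      _ ≤ _ := by rw [pow_succ]; gcongr

/-- Lower bound for the average age under an arbitrary policy. Let `Y` be the length of a stage, cut
off at some `t ≥ C`. Its cost `Y² / 2 - β Y` equals `(Y - β)² / 2 - β² / 2`, and `W` bounds the first
term from below in terms of the jamming time alone. If the mean of `W` is at least `β² / 2`, every
stage costs on average at least `β` times its length. -/
theorem ofReal_le_avgAge {μ : ProbabilityMeasure (Jam Amax)} {π : CausalPolicy Amax} {β C : ℝ}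
    (hβ : 0 ≤ β) (hC : 0 ≤ C)
    (hexp : ∫⁻ a, ENNReal.ofReal (Real.exp (-(a : ℝ))) ∂(μ : Measure (Jam Amax)) < 1)
    {W : Jam Amax → ℝ≥0∞} (hW : Measurable W)
    (hint : ENNReal.ofReal (β ^ 2 / 2) ≤ ∫⁻ a, W a ∂(μ : Measure (Jam Amax)))
    (hpath : ∀ᵐ ω ∂playLaw μ π, ∀ n, ∀ t, C ≤ t →
      W (ω n).1 ≤ ENNReal.ofReal ((min (stageLength (ω n)) t - β) ^ 2 / 2)) :
    ENNReal.ofReal β ≤ avgAge μ π := by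
  refine (tendsto_inv_ofReal_mul_ofReal β (-C)).limsup_eq.ge.trans (limsup_le_limsup ?_)
  filter_upwards [eventually_ge_atTop C] with T hT
  gcongr
  -- `V s` is the price of the time that remains at `s` until `T - C`.
  set V : ℝ → ℝ≥0∞ := fun s => ENNReal.ofReal (β * (T - C - s)) with hV
  set q : ℕ → (ℕ → Stage Amax) → ℝ≥0∞ := fun n ω => ENNReal.ofReal
    ((min (samplingTime ω (n + 1)) T - min (samplingTime ω n) T) ^ 2 / 2) with hq
  have hVm : Measurable V := by fun_prop
  have hqm : ∀ n, Measurable (q n) := fun n => by fun_prop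
  have hstep : ∀ n, ∫⁻ ω, V (samplingTime ω n) ∂playLaw μ π ≤
      ∫⁻ ω, q n ω ∂playLaw μ π + ∫⁻ ω, V (samplingTime ω (n + 1)) ∂playLaw μ π := by
    intro n
    set e : (ℕ → Stage Amax) → ℝ≥0∞ := fun ω =>
      if samplingTime ω n ≤ T - C then ENNReal.ofReal (β ^ 2 / 2) else 0 with he
    have hem : Measurable e := Measurable.ite
      (measurableSet_le (measurable_samplingTime n) measurable_const) measurable_const
      measurable_const
    have hefin : ∫⁻ ω, e ω ∂playLaw μ π ≠ ∞ := by
      refine ((lintegral_mono (g := fun _ => ENNReal.ofReal (β ^ 2 / 2)) fun ω => ?_).trans_lt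
        ?_).ne
      · simp only [he]; split_ifs <;> simp
      · simp
    have hw : Measurable fun x : ℝ × Jam Amax => if x.1 ≤ T - C then W x.2 else 0 :=
      Measurable.ite (measurableSet_le measurable_fst measurable_const) (hW.comp measurable_snd)
        measurable_const
    have hge : ∫⁻ ω, e ω ∂playLaw μ π ≤
        ∫⁻ ω, (if samplingTime ω n ≤ T - C then W (ω n).1 else 0) ∂playLaw μ π := by
      have := lintegral_samplingTime_jam μ π n hw
      dsimp only at this
      rw [this]
      refine lintegral_mono fun ω => ?_
      simp only [he]
      split_ifs
      · exact hint
      · simp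
    refine ENNReal.le_of_add_le_add_right hefin ?_
    calc ∫⁻ ω, V (samplingTime ω n) ∂playLaw μ π + ∫⁻ ω, e ω ∂playLaw μ π
        ≤ ∫⁻ ω, V (samplingTime ω n) ∂playLaw μ π +
          ∫⁻ ω, (if samplingTime ω n ≤ T - C then W (ω n).1 else 0) ∂playLaw μ π := by gcongr
      _ = ∫⁻ ω, V (samplingTime ω n) + (if samplingTime ω n ≤ T - C then W (ω n).1 else 0)
            ∂playLaw μ π :=
          (lintegral_add_left (hVm.comp (measurable_samplingTime n)) _).symm
      _ ≤ ∫⁻ ω, q n ω + V (samplingTime ω (n + 1)) + e ω ∂playLaw μ π := by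
          refine lintegral_mono_ae ?_
          filter_upwards [hpath] with ω hω
          simp only [he, hV, hq]
          split_ifs with hs
          · have hX := stageLength_nonneg (ω n)
            have hsT : samplingTime ω n ≤ T := by linarith
            have hY : min (samplingTime ω (n + 1)) T - min (samplingTime ω n) T =
                min (stageLength (ω n)) (T - samplingTime ω n) := by
              rw [min_eq_left hsT, samplingTime_succ, ← min_sub_sub_right, add_sub_cancel_left]
            have hWn := hω n (T - samplingTime ω n) (by linarith)
            rw [hY]
            set Y := min (stageLength (ω n)) (T - samplingTime ω n) with hYdef
            refine (add_le_add_right hWn _).trans ?_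
            rw [← ENNReal.ofReal_add (mul_nonneg hβ (by linarith)) (by positivity),
              add_right_comm, ← ENNReal.ofReal_add (by positivity) (by positivity)]
            -- Only the stage that passes `T` loses length by the cut-off.
            rcases min_choice (stageLength (ω n)) (T - samplingTime ω n) with h | h
            · refine (ENNReal.ofReal_le_ofReal ?_).trans ENNReal.ofReal_add_le
              rw [samplingTime_succ]
              rw [hYdef, h]
              apply le_of_eq; ring
            · refine (ENNReal.ofReal_le_ofReal ?_).trans le_self_add
              rw [hYdef, h]
              nlinarith [mul_nonneg hβ hC]
          · rw [add_zero, add_zero]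
            have : β * (T - C - samplingTime ω n) ≤ 0 :=
              mul_nonpos_of_nonneg_of_nonpos hβ (by linarith)
            rw [ENNReal.ofReal_of_nonpos this]
            exact zero_le
      _ = _ := by
          rw [lintegral_add_right _ hem, lintegral_add_left (hqm n)]
  have hsum : ∀ K, V 0 ≤ ∑ n ∈ Finset.range K, ∫⁻ ω, q n ω ∂playLaw μ π +
      ∫⁻ ω, V (samplingTime ω K) ∂playLaw μ π := by
    intro K
    induction K with
    | zero => simp [samplingTime]
    | succ K ih =>
      rw [Finset.sum_range_succ, add_assoc]
      exact ih.trans (by gcongr; exact hstep K)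
  have htail : ∀ K, ∫⁻ ω, V (samplingTime ω K) ∂playLaw μ π ≤
      ENNReal.ofReal (β * (T - C) * Real.exp (T - C)) *
        (∫⁻ a, ENNReal.ofReal (Real.exp (-(a : ℝ))) ∂(μ : Measure (Jam Amax))) ^ K := by
    intro K
    refine le_trans ?_ (mul_le_mul_right (lintegral_exp_neg_samplingTime_le μ π K) _)
    rw [← lintegral_const_mul' _ _ ENNReal.ofReal_ne_top]
    refine lintegral_mono fun ω => ?_
    have hTC : 0 ≤ β * (T - C) := mul_nonneg hβ (by linarith)
    rw [← ENNReal.ofReal_mul (by positivity), mul_assoc, ← Real.exp_add]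
    have hs := samplingTime_nonneg ω K
    rcases le_total (samplingTime ω K) (T - C) with h | h
    · refine ENNReal.ofReal_le_ofReal ?_
      have h1 : 1 ≤ Real.exp (T - C + -samplingTime ω K) := Real.one_le_exp (by linarith)
      nlinarith [mul_nonneg hβ hs]
    · simp only [hV]
      rw [ENNReal.ofReal_of_nonpos (mul_nonpos_of_nonneg_of_nonpos hβ (by linarith))]
      exact zero_le
  have hlim := (ENNReal.Tendsto.const_mul (a := ENNReal.ofReal (β * (T - C) * Real.exp (T - C)))
    (ENNReal.tendsto_pow_atTop_nhds_zero_of_lt_one hexp) (.inr ENNReal.ofReal_ne_top)).const_add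
      (∫⁻ ω, (∫⁻ t in Icc (0 : ℝ) T, age ω t) ∂playLaw μ π)
  rw [mul_zero, add_zero] at hlim
  refine ge_of_tendsto' hlim fun K => ?_
  have hV0 : ENNReal.ofReal (β * (T + -C)) = V 0 := by simp [hV, sub_eq_add_neg]
  rw [hV0]
  refine (hsum K).trans (add_le_add ?_ (htail K))
  rw [← lintegral_finsetSum _ fun n _ => hqm n]
  exact lintegral_mono fun ω => sum_le_lintegral_age ω (hC.trans hT) K

/-! ### The threshold policy -/

theorem integrable_jam (μ : ProbabilityMeasure (Jam Amax)) {f : Jam Amax → ℝ}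
    (hf : Continuous f) : Integrable f (μ : Measure (Jam Amax)) :=
  hf.integrable_of_hasCompactSupport (HasCompactSupport.of_compactSpace f)

/-- Decision function of the policy that waits until a stage has lasted for the time `β`. -/
noncomputable def threshold (β : ℝ) (a : Jam Amax) : ℝ≥0 := Real.toNNReal (β - a)

theorem measurable_threshold (β : ℝ) : Measurable (threshold (Amax := Amax) β) := by
  unfold threshold; fun_prop

theorem stageLength_threshold (β : ℝ) (a : Jam Amax) :
    stageLength (a, threshold β a) = max (a : ℝ) β := by
  simp only [stageLength, threshold, Real.coe_toNNReal']
  rw [← max_add_add_left]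
  simp [max_comm]

theorem integral_max_pos (μ : ProbabilityMeasure (Jam Amax)) {β : ℝ} (hβ : 0 < β) :
    0 < ∫ a, max (a : ℝ) β ∂(μ : Measure (Jam Amax)) := by
  have : ∫ _, β ∂(μ : Measure (Jam Amax)) ≤ ∫ a, max (a : ℝ) β ∂(μ : Measure (Jam Amax)) :=
    integral_mono (integrable_const _) (integrable_jam μ (by fun_prop)) fun a => le_max_right _ _
  simp only [integral_const, probReal_univ, one_smul] at this
  linarith

/-- The threshold policy with threshold `β` has average age at most `β` if
`E[((A - β)⁺)²] ≤ β²`; in general its average age is the renewal-reward quotient, here written as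
`β` plus the defect in this inequality, normalized by the mean stage length. -/
theorem avgAge_threshold_le (μ : ProbabilityMeasure (Jam Amax)) {π : CausalPolicy Amax} {β : ℝ}
    (hβ : 0 < β) (hβA : β ≤ Amax) (h : π.IsStationaryDeterministic (threshold β)) :
    avgAge μ π ≤ ENNReal.ofReal (β +
      (∫ a, (max (a : ℝ) β - β) ^ 2 ∂(μ : Measure (Jam Amax)) - β ^ 2) / 2 /
        ∫ a, max (a : ℝ) β ∂(μ : Measure (Jam Amax))) := by
  set m := ∫ a, max (a : ℝ) β ∂(μ : Measure (Jam Amax)) with hm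
  have im : Integrable (fun a : Jam Amax => max (a : ℝ) β) (μ : Measure (Jam Amax)) :=
    integrable_jam μ (by fun_prop)
  have iQ : Integrable (fun a : Jam Amax => max (a : ℝ) β ^ 2 / 2) (μ : Measure (Jam Amax)) :=
    integrable_jam μ (by fun_prop)
  have hmpos : 0 < m := integral_max_pos μ hβ
  have hQ0 : 0 ≤ ∫ a, max (a : ℝ) β ^ 2 / 2 ∂(μ : Measure (Jam Amax)) :=
    integral_nonneg fun a => by positivity
  have hc : β + (∫ a, (max (a : ℝ) β - β) ^ 2 ∂(μ : Measure (Jam Amax)) - β ^ 2) / 2 / m =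
      (∫ a, max (a : ℝ) β ^ 2 / 2 ∂(μ : Measure (Jam Amax))) / m := by
    have e : ∫ a, (max (a : ℝ) β - β) ^ 2 ∂(μ : Measure (Jam Amax)) =
        2 * ∫ a, max (a : ℝ) β ^ 2 / 2 ∂(μ : Measure (Jam Amax)) - 2 * β * m + β ^ 2 := by
      have e1 : ∀ a : Jam Amax, (max (a : ℝ) β - β) ^ 2 =
          2 * (max (a : ℝ) β ^ 2 / 2) - 2 * β * max (a : ℝ) β + β ^ 2 := fun a => by ring
      simp_rw [e1]
      rw [integral_add (integrable_jam μ (by fun_prop)) (integrable_const _),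
        integral_sub (iQ.const_mul 2) (im.const_mul _), integral_const_mul, integral_const_mul]
      simp [hm]
    rw [e]
    field_simp
    ring
  rw [hc]
  refine avgAge_le_of_isStationaryDeterministic h hβ (B := Amax)
    (fun a => (stageLength_threshold β a).symm ▸ le_max_right _ _)
    (fun a => (stageLength_threshold β a).symm ▸ max_le a.2.2 hβA) (by positivity) ?_
  simp_rw [stageLength_threshold]
  rw [← ofReal_integral_eq_lintegral_ofReal iQ (Eventually.of_forall fun a => by dsimp; positivity),
    ← ofReal_integral_eq_lintegral_ofReal im
      (Eventually.of_forall fun a => hβ.le.trans (le_max_right _ _)),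
    ← ENNReal.ofReal_mul (by positivity), div_mul_cancel₀ _ hmpos.ne']

/-! ### The attacker's problem -/

/-- On `[0, Amax]` the convex function `((a - β)⁺)²` lies below its chord. -/
theorem sq_max_sub_le_chord {β : ℝ} (hβ : 0 ≤ β) (hβA : β < Amax) (a : Jam Amax) :
    (max (a : ℝ) β - β) ^ 2 ≤ (a : ℝ) * ((Amax - β) ^ 2 / Amax) := by
  obtain ⟨a, ha0, haA⟩ := a
  have hA : 0 < Amax := hβ.trans_lt hβA
  dsimp only
  rw [← mul_div_assoc, le_div_iff₀ hA]
  rcases le_total a β with h | h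
  · rw [max_eq_right h, sub_self, zero_pow two_ne_zero, zero_mul]; positivity
  · rw [max_eq_left h]
    have h1 : β ^ 2 ≤ a * Amax := by nlinarith
    nlinarith [mul_nonneg (sub_nonneg.2 haA) (sub_nonneg.2 h1)]

/-- The chord touches the graph at the end points only. -/
theorem eq_zero_or_eq_of_chord_le {β : ℝ} (hβ : 0 < β) (hβA : β < Amax) {a : Jam Amax}
    (h : (a : ℝ) * ((Amax - β) ^ 2 / Amax) ≤ (max (a : ℝ) β - β) ^ 2) :
    (a : ℝ) = 0 ∨ (a : ℝ) = Amax := by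
  obtain ⟨a, ha0, haA⟩ := a
  have hA : 0 < Amax := hβ.trans hβA
  dsimp only at h ⊢
  rw [← mul_div_assoc, div_le_iff₀ hA] at h
  rcases le_total a β with hab | hab
  · left
    rw [max_eq_right hab] at h
    have : 0 < (Amax - β) ^ 2 := by have := sub_pos.2 hβA; positivity
    nlinarith
  · right
    rw [max_eq_left hab] at h
    have h1 : 0 < a * Amax - β ^ 2 := by nlinarith
    nlinarith

/-- A feasible attack keeps `E[((A - β)⁺)²]` below `β²`, where `β` is the threshold at which the
two-point attack attains equality. -/
theorem integral_sq_max_sub_le {Aavg β : ℝ} {μ : ProbabilityMeasure (Jam Amax)}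
    (hβ : 0 ≤ β) (hβA : β < Amax) (hroot : Aavg * ((Amax - β) ^ 2 / Amax) = β ^ 2)
    (hμ : IsFeasible Aavg μ) :
    ∫ a, (max (a : ℝ) β - β) ^ 2 ∂(μ : Measure (Jam Amax)) ≤ β ^ 2 := by
  have hA : 0 < Amax := hβ.trans_lt hβA
  calc _ ≤ ∫ a, (a : ℝ) * ((Amax - β) ^ 2 / Amax) ∂(μ : Measure (Jam Amax)) :=
        integral_mono (integrable_jam μ (by fun_prop)) (integrable_jam μ (by fun_prop))
          (sq_max_sub_le_chord hβ hβA)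
    _ = (∫ a, (a : ℝ) ∂(μ : Measure (Jam Amax))) * ((Amax - β) ^ 2 / Amax) :=
        integral_mul_const _ _
    _ ≤ Aavg * ((Amax - β) ^ 2 / Amax) := by gcongr; exact hμ
    _ = β ^ 2 := hroot

/-- Equality in `integral_sq_max_sub_le` forces the attack to use the two extreme jamming times
only, and to exhaust the budget. -/
theorem ae_eq_zero_or_eq_and_integral_eq {Aavg β : ℝ} {μ : ProbabilityMeasure (Jam Amax)}
    (hβ : 0 < β) (hβA : β < Amax) (hroot : Aavg * ((Amax - β) ^ 2 / Amax) = β ^ 2)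
    (hμ : IsFeasible Aavg μ)
    (h : β ^ 2 ≤ ∫ a, (max (a : ℝ) β - β) ^ 2 ∂(μ : Measure (Jam Amax))) :
    (∀ᵐ a : Jam Amax ∂(μ : Measure (Jam Amax)), (a : ℝ) = 0 ∨ (a : ℝ) = Amax) ∧
      ∫ a, (a : ℝ) ∂(μ : Measure (Jam Amax)) = Aavg := by
  have hA : 0 < Amax := hβ.trans hβA
  have hk : 0 < (Amax - β) ^ 2 / Amax := by have := sub_pos.2 hβA; positivity
  have i1 : Integrable (fun a : Jam Amax => (max (a : ℝ) β - β) ^ 2) (μ : Measure (Jam Amax)) :=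
    integrable_jam μ (by fun_prop)
  have i2 : Integrable (fun a : Jam Amax => (a : ℝ) * ((Amax - β) ^ 2 / Amax))
    (μ : Measure (Jam Amax)) := integrable_jam μ (by fun_prop)
  have hle := integral_mono i1 i2 (sq_max_sub_le_chord hβ.le hβA)
  have hmul : ∫ a, (a : ℝ) * ((Amax - β) ^ 2 / Amax) ∂(μ : Measure (Jam Amax)) =
      (∫ a, (a : ℝ) ∂(μ : Measure (Jam Amax))) * ((Amax - β) ^ 2 / Amax) :=
    integral_mul_const _ _
  have hmean : ∫ a, (a : ℝ) ∂(μ : Measure (Jam Amax)) = Aavg := by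
    refine le_antisymm hμ (le_of_mul_le_mul_right ?_ hk)
    rw [hroot, ← hmul]
    exact h.trans hle
  refine ⟨?_, hmean⟩
  have heq : ∫ a, (max (a : ℝ) β - β) ^ 2 ∂(μ : Measure (Jam Amax)) =
      ∫ a, (a : ℝ) * ((Amax - β) ^ 2 / Amax) ∂(μ : Measure (Jam Amax)) :=
    hle.antisymm (by rw [hmul, hmean, hroot]; exact h)
  filter_upwards [(integral_eq_iff_of_ae_le i1 i2
    (Eventually.of_forall (sq_max_sub_le_chord hβ.le hβA))).1 heq] with a ha
  exact eq_zero_or_eq_of_chord_le hβ hβA ha.ge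

/-! ### The two-point attack -/

/-- The attack which jams for the maximal time with probability `p` and not at all otherwise. -/
noncomputable def twoPoint (hA : 0 ≤ Amax) (p : ℝ) : Measure (Jam Amax) :=
  ENNReal.ofReal (1 - p) • Measure.dirac (⟨0, le_rfl, hA⟩ : Jam Amax) +
    ENNReal.ofReal p • Measure.dirac (⟨Amax, hA, le_rfl⟩ : Jam Amax)

theorem isProbabilityMeasure_twoPoint (hA : 0 ≤ Amax) {p : ℝ} (h0 : 0 ≤ p) (h1 : p ≤ 1) :
    IsProbabilityMeasure (twoPoint hA p) := by
  constructor
  simp [twoPoint, ← ENNReal.ofReal_add (sub_nonneg.2 h1) h0]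

theorem lintegral_twoPoint (hA : 0 ≤ Amax) (p : ℝ) (f : Jam Amax → ℝ≥0∞) :
    ∫⁻ a, f a ∂twoPoint hA p = ENNReal.ofReal (1 - p) * f ⟨0, le_rfl, hA⟩ +
      ENNReal.ofReal p * f ⟨Amax, hA, le_rfl⟩ := by
  simp [twoPoint, lintegral_add_measure, lintegral_smul_measure]

theorem lintegral_ofReal_twoPoint (hA : 0 ≤ Amax) {p : ℝ} (h0 : 0 ≤ p) (h1 : p ≤ 1)
    {f : Jam Amax → ℝ} (hf : ∀ a, 0 ≤ f a) :
    ∫⁻ a, ENNReal.ofReal (f a) ∂twoPoint hA p =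
      ENNReal.ofReal ((1 - p) * f ⟨0, le_rfl, hA⟩ + p * f ⟨Amax, hA, le_rfl⟩) := by
  rw [lintegral_twoPoint, ENNReal.ofReal_add (mul_nonneg (sub_nonneg.2 h1) (hf _))
    (mul_nonneg h0 (hf _)), ENNReal.ofReal_mul (sub_nonneg.2 h1), ENNReal.ofReal_mul h0]

theorem integral_twoPoint (hA : 0 ≤ Amax) {p : ℝ} (h0 : 0 ≤ p) (h1 : p ≤ 1) :
    ∫ a, (a : ℝ) ∂twoPoint hA p = p * Amax := by
  rw [integral_eq_lintegral_of_nonneg_ae (Eventually.of_forall fun a => a.2.1)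
    (by fun_prop), lintegral_ofReal_twoPoint hA h0 h1 fun a => a.2.1]
  rw [ENNReal.toReal_ofReal (by positivity)]
  simp

/-- A distribution concentrated on the two extreme jamming times is determined by its mean. -/
theorem eq_twoPoint {μ : ProbabilityMeasure (Jam Amax)} (hA : 0 < Amax)
    (h : ∀ᵐ a : Jam Amax ∂(μ : Measure (Jam Amax)), (a : ℝ) = 0 ∨ (a : ℝ) = Amax) :
    (μ : Measure (Jam Amax)) =
      twoPoint hA.le ((∫ a, (a : ℝ) ∂(μ : Measure (Jam Amax))) / Amax) := by
  have i1 : Integrable (fun a : Jam Amax => (a : ℝ) / Amax) (μ : Measure (Jam Amax)) :=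
    integrable_jam μ (by fun_prop)
  have hp : ∫⁻ a, ENNReal.ofReal ((a : ℝ) / Amax) ∂(μ : Measure (Jam Amax)) =
      ENNReal.ofReal ((∫ a, (a : ℝ) ∂(μ : Measure (Jam Amax))) / Amax) := by
    rw [← integral_div, ofReal_integral_eq_lintegral_ofReal i1
      (Eventually.of_forall fun a => div_nonneg a.2.1 hA.le)]
  have i2 : Integrable (fun a : Jam Amax => 1 - (a : ℝ) / Amax) (μ : Measure (Jam Amax)) :=
    integrable_jam μ (by fun_prop)
  have hq : ∫⁻ a, ENNReal.ofReal (1 - (a : ℝ) / Amax) ∂(μ : Measure (Jam Amax)) =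
      ENNReal.ofReal (1 - (∫ a, (a : ℝ) ∂(μ : Measure (Jam Amax))) / Amax) := by
    rw [← ofReal_integral_eq_lintegral_ofReal i2
      (Eventually.of_forall fun a => sub_nonneg.2 ((div_le_one hA).2 a.2.2)),
      integral_sub (integrable_const 1) i1, integral_div]
    simp
  refine Measure.ext fun s hs => ?_
  rw [← lintegral_indicator_one hs, ← lintegral_indicator_one hs, lintegral_twoPoint, ← hp, ← hq,
    ← lintegral_mul_const _ (by fun_prop), ← lintegral_mul_const _ (by fun_prop),
    ← lintegral_add_left (by fun_prop)]
  refine lintegral_congr_ae ?_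
  filter_upwards [h] with a ha
  obtain ⟨a, ha0, haA⟩ := a
  dsimp only at ha ⊢
  rcases ha with rfl | rfl
  · simp
  · simp [div_self hA.ne']

theorem lintegral_exp_neg_twoPoint_lt_one (hA : 0 < Amax) {p : ℝ} (h0 : 0 < p) (h1 : p ≤ 1) :
    ∫⁻ a, ENNReal.ofReal (Real.exp (-(a : ℝ))) ∂twoPoint hA.le p < 1 := by
  rw [lintegral_ofReal_twoPoint hA.le h0.le h1 fun a => (Real.exp_pos _).le, ← ENNReal.ofReal_one]
  refine (ENNReal.ofReal_lt_ofReal_iff one_pos).2 ?_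
  have : Real.exp (-Amax) < 1 := Real.exp_zero ▸ Real.exp_lt_exp.2 (neg_lt_zero.2 hA)
  simp only [neg_zero, Real.exp_zero]
  nlinarith

/-- Against the two-point attack no causal policy does better than `β`. -/
theorem ofReal_le_avgAge_twoPoint {μ : ProbabilityMeasure (Jam Amax)} (hA : 0 < Amax) {p β : ℝ}
    (h0 : 0 < p) (h1 : p ≤ 1) (hμ : (μ : Measure (Jam Amax)) = twoPoint hA.le p)
    (hβ : 0 ≤ β) (hβA : β ≤ Amax) (hroot : p * (Amax - β) ^ 2 = β ^ 2) (π : CausalPolicy Amax) :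
    ENNReal.ofReal β ≤ avgAge μ π := by
  refine ofReal_le_avgAge (C := Amax) hβ hA.le
    (hμ ▸ lintegral_exp_neg_twoPoint_lt_one hA h0 h1)
    (W := fun a => ENNReal.ofReal ((max (a : ℝ) β - β) ^ 2 / 2)) (by fun_prop) ?_
    (Eventually.of_forall fun ω n t ht => ?_)
  · rw [hμ, lintegral_ofReal_twoPoint hA.le h0.le h1 fun a => div_nonneg (sq_nonneg _) zero_le_two]
    refine ENNReal.ofReal_le_ofReal (le_of_eq ?_)
    dsimp only
    rw [max_eq_right hβ, max_eq_left hβA]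
    linarith
  · refine ENNReal.ofReal_le_ofReal (div_le_div_of_nonneg_right ?_ zero_le_two)
    have hY : ((ω n).1 : ℝ) ≤ min (stageLength (ω n)) t :=
      le_min (le_add_of_nonneg_right (ω n).2.2) ((ω n).1.2.2.trans ht)
    rcases le_total ((ω n).1 : ℝ) β with h | h
    · rw [max_eq_right h, sub_self, zero_pow two_ne_zero]; positivity
    · rw [max_eq_left h]
      gcongr

/-- A stationary deterministic policy attaining `β` against the two-point attack agrees with the
threshold policy almost everywhere. -/
theorem ae_eq_threshold_of_avgAge_le {μ : ProbabilityMeasure (Jam Amax)} (hA : 0 < Amax)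
    {p β : ℝ} (h0 : 0 < p) (h1 : p ≤ 1) (hμ : (μ : Measure (Jam Amax)) = twoPoint hA.le p)
    (hβ : 0 ≤ β) (hβA : β < Amax) (hroot : p * (Amax - β) ^ 2 = β ^ 2) {π : CausalPolicy Amax}
    {u : Jam Amax → ℝ≥0} (hu : π.IsStationaryDeterministic u)
    (hopt : avgAge μ π ≤ ENNReal.ofReal β) :
    u =ᵐ[(μ : Measure (Jam Amax))] threshold β := by
  set z : Jam Amax := ⟨0, le_rfl, hA.le⟩ with hz
  set e : Jam Amax := ⟨Amax, hA.le, le_rfl⟩ with he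
  set x : ℝ := stageLength (z, u z) with hx
  set y : ℝ := stageLength (e, u e) with hy
  have hx0 : 0 ≤ x := stageLength_nonneg _
  have hyA : Amax ≤ y := le_add_of_nonneg_right (u e).2
  have hp : 0 ≤ 1 - p := sub_nonneg.2 h1
  have hm : 0 < (1 - p) * x + p * y := by
    have : 0 < y := hA.trans_le hyA
    positivity
  -- The renewal-reward quotient of the policy is a lower bound for its average age.
  set β' : ℝ := ((1 - p) * x ^ 2 + p * y ^ 2) / (2 * ((1 - p) * x + p * y)) with hβ'
  have hβ'0 : 0 ≤ β' := by positivity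
  have hβ'm : β' * (2 * ((1 - p) * x + p * y)) = (1 - p) * x ^ 2 + p * y ^ 2 :=
    div_mul_cancel₀ _ (by positivity)
  have hle : ENNReal.ofReal β' ≤ avgAge μ π := by
    have hs : MeasurableSet ({z, e} : Set (Jam Amax)) := (Set.toFinite _).measurableSet
    refine ofReal_le_avgAge (C := max x y) hβ'0 (hx0.trans (le_max_left _ _))
      (hμ ▸ lintegral_exp_neg_twoPoint_lt_one hA h0 h1)
      (W := ({z, e} : Set (Jam Amax)).indicator fun a =>
        ENNReal.ofReal ((stageLength (a, u a) - β') ^ 2 / 2)) ?_ ?_ ?_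
    · have := hu.measurable
      have : Measurable fun a : Jam Amax => stageLength (a, u a) :=
        measurable_stageLength.comp (by fun_prop)
      exact Measurable.indicator (by fun_prop) hs
    · rw [hμ, lintegral_twoPoint, Set.indicator_of_mem (by simp [hz]),
        Set.indicator_of_mem (by simp [he]), ← ENNReal.ofReal_mul hp, ← ENNReal.ofReal_mul h0.le,
        ← ENNReal.ofReal_add (by positivity) (by positivity)]
      refine ENNReal.ofReal_le_ofReal (le_of_eq ?_)
      rw [← hx, ← hy]
      linarith
    · filter_upwards [hu.ae_delay_eq μ] with ω hω n t ht
      by_cases hmem : (ω n).1 ∈ ({z, e} : Set (Jam Amax))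
      · rw [Set.indicator_of_mem hmem, ← hω n]
        have hX : stageLength (ω n) ≤ t := by
          have h2 : stageLength ((ω n).1, u (ω n).1) ≤ max x y := by
            rcases hmem with h | h <;> rw [h]
            · exact le_max_left _ _
            · exact le_max_right _ _
          rw [← hω n] at h2
          exact h2.trans ht
        rw [min_eq_left hX]
      · rw [Set.indicator_of_notMem hmem]
        exact zero_le
  have hββ : β' ≤ β := (ENNReal.ofReal_le_ofReal_iff hβ).1 (hle.trans hopt)
  have hsq : (1 - p) * (x - β) ^ 2 + p * ((y - β) ^ 2 - (Amax - β) ^ 2) ≤ 0 := by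
    nlinarith [mul_le_mul_of_nonneg_right hββ hm.le]
  have hy2 : 0 ≤ (y - β) ^ 2 - (Amax - β) ^ 2 := by nlinarith
  have hye : y = Amax := by
    refine hyA.antisymm' ?_
    have h3 : 0 ≤ (1 - p) * (x - β) ^ 2 := by positivity
    have h4 : (y - β) ^ 2 - (Amax - β) ^ 2 ≤ 0 := by
      by_contra! h5
      nlinarith [mul_pos h0 h5]
    nlinarith
  have hxe : (1 - p) * (x - β) ^ 2 = 0 := by
    refine le_antisymm ?_ (by positivity)
    nlinarith [mul_nonneg h0.le hy2]
  rw [hμ, twoPoint]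
  refine ae_add_measure_iff.2 ⟨?_, Measure.ae_smul_measure ?_ _⟩
  · rcases mul_eq_zero.1 hxe with hp0 | hxβ
    · simp [hp0]
    · refine Measure.ae_smul_measure ?_ _
      rw [ae_dirac_eq]
      have hxβ' : x = β := sub_eq_zero.1 (pow_eq_zero_iff two_ne_zero |>.1 hxβ)
      refine NNReal.coe_injective ?_
      rw [← hz, threshold, Real.coe_toNNReal']
      rw [hx, stageLength] at hxβ'
      simp only [hz, zero_add] at hxβ' ⊢
      rw [hxβ', sub_zero, max_eq_left hβ]
  · rw [ae_dirac_eq]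
    refine NNReal.coe_injective ?_
    rw [← he, threshold, Real.coe_toNNReal', max_eq_right (by simp only [he]; linarith)]
    rw [hy, stageLength] at hye
    simp only [he] at hye ⊢
    linarith

/-! ### The equilibrium threshold -/

theorem equilibriumThreshold_spec {Amax Aavg : ℝ} (hpos : 0 < Aavg) (hle : Aavg ≤ Amax) :
    0 < Amax * √Aavg / (√Amax + √Aavg) ∧ Amax * √Aavg / (√Amax + √Aavg) < Amax ∧
      Aavg / Amax * (Amax - Amax * √Aavg / (√Amax + √Aavg)) ^ 2 =
        (Amax * √Aavg / (√Amax + √Aavg)) ^ 2 := by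
  have hA : 0 < Amax := hpos.trans_le hle
  have hs : 0 < √Amax := Real.sqrt_pos.2 hA
  have hr : 0 < √Aavg := Real.sqrt_pos.2 hpos
  refine ⟨by positivity, ?_, ?_⟩
  · rw [div_lt_iff₀ (by positivity)]
    exact mul_lt_mul_of_pos_left (by linarith) hA
  · have e1 : Amax - Amax * √Aavg / (√Amax + √Aavg) = Amax * √Amax / (√Amax + √Aavg) := by
      field_simp; ring
    rw [e1, div_pow, div_pow, mul_pow, mul_pow, Real.sq_sqrt hA.le, Real.sq_sqrt hpos.le]
    field_simp

end JammingGame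

theorem theorem1 (Amax Aavg : ℝ) (hpos : 0 < Aavg) (hle : Aavg ≤ Amax) :
    ∃ (μs : ProbabilityMeasure (JammingGame.Jam Amax)) (us : JammingGame.Jam Amax → ℝ≥0),
      (μs : Measure (JammingGame.Jam Amax)) =
        ENNReal.ofReal (1 - Aavg / Amax) •
            Measure.dirac (⟨0, le_rfl, hpos.le.trans hle⟩ : JammingGame.Jam Amax) +
          ENNReal.ofReal (Aavg / Amax) •
            Measure.dirac (⟨Amax, hpos.le.trans hle, le_rfl⟩ : JammingGame.Jam Amax) ∧
      (∀ a : JammingGame.Jam Amax,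
        (us a : ℝ) = max (Amax * √Aavg / (√Amax + √Aavg) - (a : ℝ)) 0) ∧
      JammingGame.IsStationaryEquilibrium Aavg μs us ∧
      ∀ (μ : ProbabilityMeasure (JammingGame.Jam Amax)) (u : JammingGame.Jam Amax → ℝ≥0),
        JammingGame.IsStationaryEquilibrium Aavg μ u →
          μ = μs ∧ u =ᵐ[(μs : Measure (JammingGame.Jam Amax))] us := by
  open JammingGame in
  have hA : 0 < Amax := hpos.trans_le hle
  have hp0 : 0 < Aavg / Amax := div_pos hpos hA
  have hp1 : Aavg / Amax ≤ 1 := (div_le_one hA).2 hle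
  obtain ⟨hβ, hβA, hroot⟩ := equilibriumThreshold_spec hpos hle
  set β : ℝ := Amax * √Aavg / (√Amax + √Aavg)
  have hroot' : Aavg * ((Amax - β) ^ 2 / Amax) = β ^ 2 := by rw [← hroot]; ring
  let μs : ProbabilityMeasure (Jam Amax) :=
    ⟨twoPoint hA.le (Aavg / Amax), isProbabilityMeasure_twoPoint hA.le hp0.le hp1⟩
  let πs : CausalPolicy Amax := stationaryPolicy (threshold β) (measurable_threshold β)
  have hπs : πs.IsStationaryDeterministic (threshold β) :=
    isStationaryDeterministic_stationaryPolicy _ _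
  have hupper : ∀ μ : ProbabilityMeasure (Jam Amax), IsFeasible Aavg μ →
      avgAge μ πs ≤ ENNReal.ofReal β := fun μ hμ => by
    refine (avgAge_threshold_le μ hβ hβA.le hπs).trans (ENNReal.ofReal_le_ofReal ?_)
    have h1 := integral_sq_max_sub_le hβ.le hβA hroot' hμ
    have h2 := div_nonpos_of_nonpos_of_nonneg
      (div_nonpos_of_nonpos_of_nonneg (sub_nonpos.2 h1) zero_le_two) (integral_max_pos μ hβ).le
    linarith
  have hlower : ∀ π, ENNReal.ofReal β ≤ avgAge μs π :=
    ofReal_le_avgAge_twoPoint hA hp0 hp1 rfl hβ.le hβA.le hroot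
  have hfeas : IsFeasible Aavg μs := by
    refine (integral_twoPoint hA.le hp0.le hp1).le.trans_eq ?_
    field_simp
  refine ⟨μs, threshold β, rfl, fun a => Real.coe_toNNReal' _, ⟨πs, hπs, ?_, hfeas, ?_⟩, ?_⟩
  · exact fun π' => (hupper μs hfeas).trans (hlower π')
  · exact fun μ' hμ' => (iInf_le _ πs).trans ((hupper μ' hμ').trans (le_iInf hlower))
  · rintro μ u ⟨π, hπ, hopt, hμ, hatt⟩
    have hμs : μ = μs := by
      have h1 : ENNReal.ofReal β ≤ avgAge μ πs :=
        (le_iInf hlower).trans ((hatt μs hfeas).trans (iInf_le _ πs))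
      have h2 := h1.trans (avgAge_threshold_le μ hβ hβA.le hπs)
      have h3 : β ^ 2 ≤ ∫ a, (max (a : ℝ) β - β) ^ 2 ∂(μ : Measure (Jam Amax)) := by
        by_contra! hlt
        have h4 := div_neg_of_neg_of_pos (div_neg_of_neg_of_pos (sub_neg.2 hlt) two_pos)
          (integral_max_pos μ hβ)
        exact absurd h2 (not_le.2 ((ENNReal.ofReal_lt_ofReal_iff hβ).2 (by linarith)))
      obtain ⟨hae, hmean⟩ := ae_eq_zero_or_eq_and_integral_eq hβ hβA hroot' hμ h3
      refine Subtype.ext ?_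
      have h5 := eq_twoPoint hA hae
      rwa [hmean] at h5
    subst hμs
    exact ⟨rfl, ae_eq_threshold_of_avgAge_le hA hp0 hp1 rfl hβ.le hβA hroot hπ
      ((hopt πs).trans (hupper μs hfeas))⟩
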